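/- Let $G=(V,E)$ be a finite multi-edged tree, that is, a finite connected graph, possibly with multiple edges (loops are disregarded), whose underlying simple graph is a tree. A divisor is a vector $D\in\mathbb{Z}^V$; two divisors are equivalent if they differ by an element of $L\,\mathbb{Z}^V$, where $L$ is the Laplacian matrix of $G$ (degrees on the diagonal, minus the numbers of joining edges off the diagonal). Let $\Delta_D$ be the simplicial complex of all $W\subseteq V$ such that $W\subseteq\operatorname{supp}(D_0)$ for some divisor $D_0\ge 0$ equivalent to $D$, and let $$\beta_{k,D}=\dim_{\mathbb{C}}\widetilde H_{k-1}(\Delta_D,\mathbb{C})$$ be the $k$-th Betti number of $D$. For disjoint $A,B\subseteq V$ and $v\in V$ let $\deg_{AB}(v)$ be the number of edges between $A$ and $B$ that are incident to $v$. A cut of a connected vertex set $C$ is a partition of $C$ into two (nonempty) sets $A,B$, each inducing a connected subgraph. Let $k\ge 1$ and let $\Pi$ be a partition of $V$ into $k+1$ parts, each inducing a connected subgraph. A generating sequence of $\Pi$ is a sequence of cuts $C_1,\dots,C_k$, with components $A_i,B_i$ of $C_i$, such that $C_1$ is a cut of $V$, each $C_i$ with $i\ge2$ is a cut of $A_{i-1}$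 or of $B_{i-1}$, and applying the cuts one after the other to the one-part partition $\{V\}$ yields $\Pi$. A divisor $D$ is a $\Pi$-boundary divisor if there are a generating sequence of $\Pi$ and a choice of $X_i\in\{A_i,B_i\}$ for $i=1,\dots,k$ such that $$D_v=\sum_{i=1}^k\deg_{A_iB_i}(v)\,\chi_{X_i}(v)\qquad\text{for all } v\in V,$$ where $\chi_X$ is the characteristic function of $X$. If $D$ is a $\Pi$-boundary divisor, then $\beta_{k,D}>0$; that is, $\widetilde H_{k-1}(\Delta_D,\mathbb{C})\neq 0$. -/

import Mathlib

namespace Sandpile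

open scoped Matrix

variable {V E : Type*}

/-! ### Multigraphs

A finite multigraph is a Mathlib `Graph V E` with finite types `V` of vertices and `E` of edges.
Loops are disregarded: every definition below ignores them. -/

/-- The simple graph on `V` underlying a multigraph: two distinct vertices are adjacent if and only
if at least one edge joins them. -/
def underlying (G : Graph V E) : SimpleGraph V where
  Adj u v := u ≠ v ∧ G.Adj u v
  symm := ⟨fun _ _ h => ⟨h.1.symm, h.2.symm⟩⟩
  loopless := ⟨fun _ h => h.1 rfl⟩

/-- A multi-edged tree: a tree in which multiple edges are allowed, that is, a multigraph on the
vertex set `V` whose underlying simple graph is a tree. -/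
structure IsMultiEdgedTree (G : Graph V E) : Prop where
  vertexSet_eq : G.vertexSet = Set.univ
  isTree : (underlying G).IsTree

/-- A set of vertices is connected if it is nonempty and the graph induced on it is connected. -/
def IsConnectedSet (G : Graph V E) (A : Finset V) : Prop :=
  ((underlying G).induce (A : Set V)).Connected

/-- The degree of a vertex: the number of edges (other than loops) incident to it. -/
noncomputable def degree (G : Graph V E) (v : V) : ℕ :=
  {e : E | G.IsNonloopAt e v}.ncard

/-- The number of edges that join `u` and `v`. -/
noncomputable def edgeCount (G : Graph V E) (u v : V) : ℕ :=
  {e : E | G.IsLink e u v}.ncard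

/-- The crossing-degree of `v` with respect to `A` and `B`: the number of edges that are incident
to `v` and run between `A` and `B`. -/
noncomputable def crossingDegree (G : Graph V E) (A B : Finset V) (v : V) : ℕ :=
  {e : E | G.Inc e v ∧ ∃ a ∈ A, ∃ b ∈ B, G.IsLink e a b}.ncard

/-! ### Divisors and linear systems -/

/-- The Laplacian matrix: degrees on the diagonal, minus the number of edges off the diagonal. -/
noncomputable def laplacian [DecidableEq V] (G : Graph V E) : Matrix V V ℤ :=
  Matrix.of fun u v => if u = v then (degree G u : ℤ) else -(edgeCount G u v : ℤ)

/-- Two divisors (integer vectors indexed by the vertices) are equivalent if they differ by an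
element of the image of the Laplacian. -/
def DivEquiv [Fintype V] [DecidableEq V] (G : Graph V E) (D₀ D₁ : V → ℤ) : Prop :=
  ∃ σ : V → ℤ, D₀ - laplacian G *ᵥ σ = D₁

/-- The linear system `|D|`: the effective (that is, non-negative) divisors equivalent to `D`. -/
def linearSystem [Fintype V] [DecidableEq V] (G : Graph V E) (D : V → ℤ) : Set (V → ℤ) :=
  {D₁ | DivEquiv G D D₁ ∧ 0 ≤ D₁}

/-- The simplicial complex `Δ_D`: all sets of vertices that are contained in the support of some
element of `|D|`. The empty set is a face as soon as `|D|` is nonempty. -/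
def complexOf [Fintype V] [DecidableEq V] (G : Graph V E) (D : V → ℤ) : Set (Finset V) :=
  {W | ∃ D₀ ∈ linearSystem G D, (W : Set V) ⊆ Function.support D₀}

/-- `Δ_D` is closed under passing to subsets. -/
theorem complexOf_down_closed [Fintype V] [DecidableEq V] (G : Graph V E) (D : V → ℤ) :
    ∀ W ∈ complexOf G D, ∀ U ⊆ W, U ∈ complexOf G D := by
  rintro W ⟨D₀, h, hW⟩ U hU
  exact ⟨D₀, h, (Finset.coe_subset.2 hU).trans hW⟩

/-! ### Reduced simplicial homology over the complex numbers

A total order on the vertices orients all the faces. A family `Δ` of finite sets that is closed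
under passing to subsets is a simplicial complex; its faces of dimension `j - 1` are its members
with `j` elements, and the empty set is the face of dimension `-1`. -/

/-- The simplicial boundary map on formal complex combinations of sets of vertices, which are
written as coefficient functions: it sends `{v₀ < v₁ < ... < vᵣ}` to the sum over `i` of `(-1) ^ i`
times the set with `vᵢ` removed. Thus the coefficient of `W` in the image of `c` collects, for all
`v ∉ W`, the coefficient of `W ∪ {v}` in `c` with the sign given by the position of `v`. -/
noncomputable def boundary (V : Type*) [Fintype V] [LinearOrder V] :
    (Finset V → ℂ) →ₗ[ℂ] (Finset V → ℂ) where
  toFun c W := ∑ v ∈ Wᶜ, (-1 : ℂ) ^ (W.filter (· < v)).card * c (insert v W)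
  map_add' c d := by
    funext W
    simp [mul_add, Finset.sum_add_distrib]
  map_smul' r c := by
    funext W
    simp [Finset.mul_sum, mul_left_comm]

/-- The chains of dimension `j - 1`: the combinations of the faces of `Δ` with `j` elements. -/
def chains (Δ : Set (Finset V)) (j : ℕ) : Submodule ℂ (Finset V → ℂ) where
  carrier := {c | ∀ W, c W ≠ 0 → W ∈ Δ ∧ W.card = j}
  zero_mem' := fun W h => absurd rfl h
  add_mem' := by
    intro c d hc hd W h
    by_cases hcW : c W = 0
    · exact hd W fun hdW => h (by simp [hcW, hdW])
    · exact hc W hcW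
  smul_mem' := by
    intro r c hc W h
    exact hc W fun hcW => h (by simp [hcW])

/-- The cycles of dimension `j - 1`. -/
noncomputable def cycles [Fintype V] [LinearOrder V] (Δ : Set (Finset V)) (j : ℕ) :
    Submodule ℂ (Finset V → ℂ) :=
  chains Δ j ⊓ LinearMap.ker (boundary V)

/-- The boundaries of dimension `j - 1`: the images of the chains of dimension `j`. -/
noncomputable def boundaries [Fintype V] [LinearOrder V] (Δ : Set (Finset V)) (j : ℕ) :
    Submodule ℂ (Finset V → ℂ) :=
  (chains Δ (j + 1)).map (boundary V)

/-- The composite of two boundary maps is zero. -/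
theorem boundary_boundary [Fintype V] [LinearOrder V] (c : Finset V → ℂ) :
    boundary V (boundary V c) = 0 := by
  have key : ∀ (W : Finset V) (u v : V), v ∉ W →
      (-1 : ℂ) ^ ((insert v W).filter (· < u)).card =
        (if v < u then -1 else 1) * (-1 : ℂ) ^ (W.filter (· < u)).card := by
    intro W u v hv
    rw [Finset.filter_insert]
    split_ifs with h
    · rw [Finset.card_insert_of_notMem (by simp [hv]), pow_succ]; ring
    · simp
  funext W
  change ∑ v ∈ Wᶜ, (-1 : ℂ) ^ (W.filter (· < v)).card *
    ∑ u ∈ (insert v W)ᶜ, (-1 : ℂ) ^ ((insert v W).filter (· < u)).card *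
      c (insert u (insert v W)) = 0
  simp_rw [Finset.mul_sum]
  rw [Finset.sum_sigma']
  refine Finset.sum_involution (fun p _ => ⟨p.2, p.1⟩) ?_ ?_ ?_ ?_
  · rintro ⟨v, u⟩ h
    simp only [Finset.mem_sigma, Finset.mem_compl, Finset.mem_insert, not_or] at h
    obtain ⟨hv, huv, hu⟩ := h
    simp only
    rw [key W u v hv, key W v u hu, Finset.insert_comm v u]
    rcases lt_or_gt_of_ne huv with h | h
    · rw [if_neg h.not_gt, if_pos h]; ring
    · rw [if_pos h, if_neg h.not_gt]; ring
  · rintro ⟨v, u⟩ h _ he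
    simp only [Finset.mem_sigma, Finset.mem_compl, Finset.mem_insert, not_or] at h
    simp only [Sigma.mk.injEq] at he
    exact h.2.1 he.1
  · rintro ⟨v, u⟩ h
    simp only [Finset.mem_sigma, Finset.mem_compl, Finset.mem_insert, not_or] at h ⊢
    exact ⟨h.2.2, fun e => h.2.1 e.symm, h.1⟩
  · rintro ⟨v, u⟩ h
    rfl

/-- In a simplicial complex every boundary is a cycle. -/
theorem boundaries_le_cycles [Fintype V] [LinearOrder V] (Δ : Set (Finset V))
    (hΔ : ∀ W ∈ Δ, ∀ U ⊆ W, U ∈ Δ) (j : ℕ) : boundaries Δ j ≤ cycles Δ j := by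
  rintro _ ⟨c, hc, rfl⟩
  refine ⟨fun W hW => ?_, boundary_boundary c⟩
  obtain ⟨v, hv, hne⟩ := Finset.exists_ne_zero_of_sum_ne_zero hW
  obtain ⟨h1, h2⟩ := hc _ (right_ne_zero_of_mul hne)
  rw [Finset.card_insert_of_notMem (by simpa using hv)] at h2
  exact ⟨hΔ _ h1 _ (Finset.subset_insert v W), by omega⟩

/-- The reduced homology of `Δ` with complex coefficients in dimension `j - 1`: cycles modulo
boundaries. -/
abbrev ReducedHomology [Fintype V] [LinearOrder V] (Δ : Set (Finset V)) (j : ℕ) : Type _ :=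
  cycles Δ j ⧸ (boundaries Δ j).submoduleOf (cycles Δ j)

/-- The `k`-th Betti number of the divisor `D`: the complex dimension of the reduced homology
of `Δ_D` in dimension `k - 1`. -/
noncomputable def betti [Fintype V] [LinearOrder V] (G : Graph V E) (k : ℕ) (D : V → ℤ) : ℕ :=
  Module.finrank ℂ (ReducedHomology (complexOf G D) k)

/-! ### Partitions, cuts and boundary divisors -/

/-- The partition `P` of the vertex set lies in `𝒫_m`: it has exactly `m` parts and each of them is
connected. -/
structure IsConnectedPartition [Fintype V] [DecidableEq V] (G : Graph V E) (m : ℕ)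
    (P : Finpartition (Finset.univ : Finset V)) : Prop where
  card_parts : P.parts.card = m
  connected : ∀ A ∈ P.parts, IsConnectedSet G A

/-- A cut of the (connected) set of vertices `C` with components `A` and `B`: a partition of `C`
into two connected parts `A` and `B`. -/
structure IsCut [DecidableEq V] (G : Graph V E) (C A B : Finset V) : Prop where
  disjoint : Disjoint A B
  union_eq : A ∪ B = C
  connected_left : IsConnectedSet G A
  connected_right : IsConnectedSet G B

/-- The parts after the first `m` cuts of a sequence are applied to the one-part partition of the
vertex set; the `i`-th cut replaces the part `A i ∪ B i` by the two parts `A i` and `B i`. -/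
def partsAfter [Fintype V] [DecidableEq V] (A B : ℕ → Finset V) : ℕ → Finset (Finset V)
  | 0 => {Finset.univ}
  | m + 1 => insert (A m) (insert (B m) ((partsAfter A B m).erase (A m ∪ B m)))

/-- The cuts with components `A i` and `B i`, for `i = 0, ..., k - 1`, form a generating sequence of
the partition `P`: the cut with index `0` is a cut of the whole graph, each later one is a cut of
one of the two components produced by the cut just before it, and the cuts, applied one after the
other, produce `P`. (The values of `A` and `B` at indices from `k` on play no role.) -/
structure IsGeneratingSequence [Fintype V] [DecidableEq V] (G : Graph V E) (k : ℕ)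
    (P : Finpartition (Finset.univ : Finset V)) (A B : ℕ → Finset V) : Prop where
  first : 0 < k → IsCut G Finset.univ (A 0) (B 0)
  next : ∀ i, i + 1 < k →
    IsCut G (A i) (A (i + 1)) (B (i + 1)) ∨ IsCut G (B i) (A (i + 1)) (B (i + 1))
  produces : partsAfter A B k = P.parts

/-- `D` is a boundary divisor with respect to the partition `P` into `k + 1` parts: for some
generating sequence of `P` and some choice `X i ∈ {A i, B i}`, the divisor `D` is the sum of the
crossing-degrees with respect to `A i` and `B i`, restricted to `X i`. -/
def IsBoundaryDivisor [Fintype V] [DecidableEq V] (G : Graph V E) (k : ℕ)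
    (P : Finpartition (Finset.univ : Finset V)) (D : V → ℤ) : Prop :=
  ∃ A B : ℕ → Finset V, IsGeneratingSequence G k P A B ∧
    ∃ X : ℕ → Finset V, (∀ i < k, X i = A i ∨ X i = B i) ∧
      ∀ v, D v = ∑ i ∈ Finset.range k,
        if v ∈ X i then (crossingDegree G (A i) (B i) v : ℤ) else 0

end Sandpile

namespace Sandpile

open scoped Matrix

section Operators

variable {V : Type*} [LinearOrder V]

/-- The sign of inserting `v` into `W`, given by the position of `v`. -/
noncomputable def insertSign (W : Finset V) (v : V) : ℂ := (-1) ^ (W.filter (· < v)).card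

/-- Exterior multiplication of chains by a vertex. -/
noncomputable def wedge (x : V) : (Finset V → ℂ) →ₗ[ℂ] (Finset V → ℂ) where
  toFun c W := if x ∈ W then insertSign (W.erase x) x * c (W.erase x) else 0
  map_add' c d := by
    funext W
    by_cases h : x ∈ W <;> simp [h, mul_add]
  map_smul' r c := by
    funext W
    by_cases h : x ∈ W <;> simp [h, mul_left_comm]

theorem wedge_apply (x : V) (c : Finset V → ℂ) (W : Finset V) :
    wedge x c W = if x ∈ W then insertSign (W.erase x) x * c (W.erase x) else 0 := rfl

theorem insertSign_mul_self (W : Finset V) (v : V) : insertSign W v * insertSign W v = 1 := by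
  rw [insertSign, ← mul_pow]
  simp

theorem insertSign_insert {W : Finset V} {v : V} (hv : v ∉ W) (u : V) :
    insertSign (insert v W) u = (if v < u then -1 else 1) * insertSign W u := by
  rw [insertSign, insertSign, Finset.filter_insert]
  split_ifs with h
  · rw [Finset.card_insert_of_notMem (by simp [hv]), pow_succ]; ring
  · simp

theorem insertSign_swap {S : Finset V} {v x : V} (hv : v ∉ S) (hx : x ∉ S) (hne : v ≠ x) :
    insertSign (insert x S) v * insertSign (insert v S) x =
      -(insertSign S x * insertSign S v) := by
  rw [insertSign_insert hx, insertSign_insert hv]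
  rcases lt_or_gt_of_ne hne with h | h
  · rw [if_neg h.not_gt, if_pos h]; ring
  · rw [if_pos h, if_neg h.not_gt]; ring

theorem wedge_single {x : V} {S : Finset V} (hx : x ∉ S) :
    wedge x (Pi.single S 1) = insertSign S x • Pi.single (insert x S) 1 := by
  funext W
  rw [wedge_apply, Pi.smul_apply, smul_eq_mul]
  by_cases h : W = insert x S
  · subst h
    simp [Finset.erase_insert hx]
  · rw [Pi.single_eq_of_ne h, mul_zero]
    split_ifs with hW
    · rw [Pi.single_eq_of_ne, mul_zero]
      rintro rfl
      exact h (Finset.insert_erase hW).symm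
    · rfl

theorem wedge_single_of_mem {x : V} {S : Finset V} (hx : x ∈ S) :
    wedge x (Pi.single S (1 : ℂ)) = 0 := by
  funext W
  rw [wedge_apply, Pi.zero_apply]
  split_ifs with hW
  · rw [Pi.single_eq_of_ne, mul_zero]
    rintro rfl
    exact Finset.notMem_erase x W hx
  · rfl

/-- Exterior multiplication by the difference of two vertices. -/
noncomputable def wedgeDiff (x y : V) : (Finset V → ℂ) →ₗ[ℂ] (Finset V → ℂ) := wedge x - wedge y

theorem wedgeDiff_apply_empty (x y : V) (c : Finset V → ℂ) : wedgeDiff x y c ∅ = 0 := by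
  simp [wedgeDiff, wedge_apply]

variable [Fintype V]

/-- Contraction of chains with a function on the vertices. -/
noncomputable def contraction (g : V → ℂ) : (Finset V → ℂ) →ₗ[ℂ] (Finset V → ℂ) where
  toFun c W := ∑ v ∈ Wᶜ, insertSign W v * g v * c (insert v W)
  map_add' c d := by
    funext W
    simp [mul_add, Finset.sum_add_distrib]
  map_smul' r c := by
    funext W
    simp [Finset.mul_sum, mul_left_comm]

theorem contraction_apply (g : V → ℂ) (c : Finset V → ℂ) (W : Finset V) :
    contraction g c W = ∑ v ∈ Wᶜ, insertSign W v * g v * c (insert v W) := rfl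

theorem boundary_eq_contraction : boundary V = contraction (fun _ => 1) := by
  ext c W
  simp [boundary, contraction, insertSign]

theorem contraction_wedge (g : V → ℂ) (x : V) (c : Finset V → ℂ) :
    contraction g (wedge x c) = g x • c - wedge x (contraction g c) := by
  funext W
  rw [Pi.sub_apply, Pi.smul_apply, smul_eq_mul, wedge_apply, contraction_apply]
  by_cases hx : x ∈ W
  · obtain ⟨S, hS, rfl⟩ : ∃ S, x ∉ S ∧ insert x S = W :=
      ⟨W.erase x, Finset.notMem_erase x W, Finset.insert_erase hx⟩
    have hc : Sᶜ = insert x (insert x S)ᶜ := by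
      ext v
      by_cases h : v = x <;> simp [h, hS]
    rw [if_pos hx, Finset.erase_insert hS, contraction_apply, hc, Finset.sum_insert (by simp),
      mul_add, ← mul_assoc, ← mul_assoc, insertSign_mul_self, Finset.mul_sum]
    have : ∀ v ∈ (insert x S)ᶜ,
        insertSign (insert x S) v * g v * wedge x c (insert v (insert x S)) =
          -(insertSign S x * (insertSign S v * g v * c (insert v S))) := by
      intro v hv
      simp only [Finset.mem_compl, Finset.mem_insert, not_or] at hv
      have he : (insert v (insert x S)).erase x = insert v S := by
        rw [Finset.insert_comm, Finset.erase_insert]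
        simp [hS, Ne.symm hv.1]
      rw [wedge_apply, if_pos (by simp), he]
      linear_combination (g v * c (insert v S)) * insertSign_swap hv.2 hS hv.1
    rw [Finset.sum_congr rfl this, Finset.sum_neg_distrib]
    ring
  · rw [if_neg hx, sub_zero, Finset.sum_eq_single_of_mem x (by simpa using hx)]
    · rw [wedge_apply, if_pos (by simp), Finset.erase_insert hx]
      linear_combination (g x * c W) * insertSign_mul_self W x
    · intro v _ hv
      rw [wedge_apply, if_neg (by simp [hx, Ne.symm hv]), mul_zero]

theorem contraction_single_empty (g : V → ℂ) : contraction g (Pi.single ∅ 1) = 0 := by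
  funext W
  rw [contraction_apply]
  exact Finset.sum_eq_zero fun v _ => by
    rw [Pi.single_eq_of_ne (Finset.insert_ne_empty v W), mul_zero]

theorem contraction_wedgeDiff (g : V → ℂ) (x y : V) (c : Finset V → ℂ) :
    contraction g (wedgeDiff x y c) = (g x - g y) • c - wedgeDiff x y (contraction g c) := by
  simp only [wedgeDiff, LinearMap.sub_apply, map_sub, contraction_wedge, sub_smul]
  abel

/-- The exterior product of the differences `a i - b i` for `i < n`. -/
noncomputable def diffProduct (a b : ℕ → V) : ℕ → Finset V → ℂ
  | 0 => Pi.single ∅ 1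
  | n + 1 => wedgeDiff (a n) (b n) (diffProduct a b n)

/-- Successive contraction with the functions `g i` for `i < n`, in decreasing order. -/
noncomputable def iterContraction (g : ℕ → V → ℂ) : ℕ → (Finset V → ℂ) →ₗ[ℂ] (Finset V → ℂ)
  | 0 => LinearMap.id
  | n + 1 => iterContraction g n ∘ₗ contraction (g n)

theorem contraction_diffProduct (f : V → ℂ) (a b : ℕ → V) (n : ℕ)
    (h : ∀ i < n, f (a i) = f (b i)) : contraction f (diffProduct a b n) = 0 := by
  induction n with
  | zero => exact contraction_single_empty f
  | succ n ih =>
    rw [diffProduct, contraction_wedgeDiff, ih fun i hi => h i (hi.trans n.lt_succ_self),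
      h n n.lt_succ_self]
    simp

theorem iterContraction_diffProduct (g : ℕ → V → ℂ) (a b : ℕ → V) (n : ℕ)
    (h1 : ∀ i < n, g i (a i) - g i (b i) = 1) (h0 : ∀ i < n, ∀ j < i, g i (a j) = g i (b j)) :
    iterContraction g n (diffProduct a b n) ∅ = 1 := by
  induction n with
  | zero => simp [iterContraction, diffProduct]
  | succ n ih =>
    rw [diffProduct, iterContraction, LinearMap.comp_apply, contraction_wedgeDiff,
      contraction_diffProduct _ _ _ _ (h0 n n.lt_succ_self), h1 n n.lt_succ_self, map_zero,
      sub_zero, one_smul]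
    exact ih (fun i hi => h1 i (hi.trans n.lt_succ_self))
      fun i hi => h0 i (hi.trans n.lt_succ_self)

theorem iterContraction_wedgeDiff (g : ℕ → V → ℂ) (x y : V) (n : ℕ)
    (h : ∀ i < n, g i x = g i y) (c : Finset V → ℂ) :
    iterContraction g n (wedgeDiff x y c) ∅ = 0 := by
  induction n generalizing c with
  | zero => exact wedgeDiff_apply_empty x y c
  | succ n ih =>
    rw [iterContraction, LinearMap.comp_apply, contraction_wedgeDiff, h n n.lt_succ_self, sub_self,
      zero_smul, zero_sub, map_neg, Pi.neg_apply, ih fun i hi => h i (hi.trans n.lt_succ_self),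
      neg_zero]

theorem iterContraction_boundary_single (g : ℕ → V → ℂ) {x y : V} (hxy : x ≠ y) {W : Finset V}
    (hx : x ∈ W) (hy : y ∈ W) (n : ℕ) (h : ∀ i < n, g i x = g i y) :
    iterContraction g n (boundary V (Pi.single W 1)) ∅ = 0 := by
  have hW : Pi.single W (1 : ℂ) = insertSign (W.erase x) x •
      wedgeDiff x y (Pi.single (W.erase x) (1 : ℂ)) := by
    rw [wedgeDiff, LinearMap.sub_apply, wedge_single (Finset.notMem_erase x W),
      wedge_single_of_mem (Finset.mem_erase.2 ⟨hxy.symm, hy⟩), sub_zero, smul_smul,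
      insertSign_mul_self, one_smul, Finset.insert_erase hx]
  rw [hW, map_smul, map_smul, boundary_eq_contraction, contraction_wedgeDiff, sub_self, zero_smul,
    zero_sub, map_neg, Pi.smul_apply, Pi.neg_apply, iterContraction_wedgeDiff g x y n h]
  simp

theorem iterContraction_boundary (g : ℕ → V → ℂ) (n : ℕ) (c : Finset V → ℂ)
    (h : ∀ W, c W ≠ 0 → ∃ x ∈ W, ∃ y ∈ W, x ≠ y ∧ ∀ i < n, g i x = g i y) :
    iterContraction g n (boundary V c) ∅ = 0 := by
  have hc : c = ∑ W, c W • Pi.single W (1 : ℂ) := by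
    funext U
    simp [Finset.sum_apply, Pi.single_apply]
  rw [hc, map_sum, map_sum, Finset.sum_apply]
  refine Finset.sum_eq_zero fun W _ => ?_
  by_cases h0 : c W = 0
  · simp [h0]
  · obtain ⟨x, hx, y, hy, hxy, hg⟩ := h W h0
    rw [map_smul, map_smul, Pi.smul_apply,
      iterContraction_boundary_single g hxy hx hy n hg, smul_zero]

theorem diffProduct_support (a b : ℕ → V) (n : ℕ) (W : Finset V) (h : diffProduct a b n W ≠ 0) :
    W.card = n ∧ ∃ y : ℕ → V, (∀ i < n, y i = a i ∨ y i = b i) ∧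
      W ⊆ (Finset.range n).image y := by
  induction n generalizing W with
  | zero =>
    have hW : W = ∅ := by
      by_contra hne
      exact h (Pi.single_eq_of_ne hne _)
    subst hW
    exact ⟨rfl, a, by simp, by simp⟩
  | succ n ih =>
    obtain ⟨x, hx, hxW, hne⟩ : ∃ x, (x = a n ∨ x = b n) ∧ x ∈ W ∧
        diffProduct a b n (W.erase x) ≠ 0 := by
      by_contra! hcon
      apply h
      have key : ∀ x, (x = a n ∨ x = b n) → wedge x (diffProduct a b n) W = 0 := by
        intro x hx
        rw [wedge_apply]
        split_ifs with hxW
        · rw [hcon x hx hxW, mul_zero]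
        · rfl
      rw [diffProduct, wedgeDiff, LinearMap.sub_apply, Pi.sub_apply, key _ (Or.inl rfl),
        key _ (Or.inr rfl), sub_zero]
    obtain ⟨hcard, y, hy, hsub⟩ := ih _ hne
    refine ⟨by rw [← Finset.card_erase_add_one hxW, hcard], Function.update y n x, ?_, ?_⟩
    · intro i hi
      rcases eq_or_ne i n with rfl | hin
      · simpa using hx
      · rw [Function.update_of_ne hin]
        exact hy i (by omega)
    · intro v hv
      rw [Finset.mem_image]
      rcases eq_or_ne v x with rfl | hvx
      · exact ⟨n, by simp, by simp⟩
      · obtain ⟨i, hi, rfl⟩ := Finset.mem_image.1 (hsub (Finset.mem_erase.2 ⟨hvx, hv⟩))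
        rw [Finset.mem_range] at hi
        exact ⟨i, by simp; omega, by rw [Function.update_of_ne hi.ne]⟩

/-- A cycle that pairs to one with a cochain vanishing on all boundaries gives a nonzero class. -/
theorem finrank_reducedHomology_pos (Δ : Set (Finset V)) (k : ℕ) (a b : ℕ → V) (g : ℕ → V → ℂ)
    (h1 : ∀ i < k, g i (a i) - g i (b i) = 1) (h0 : ∀ i < k, ∀ j < i, g i (a j) = g i (b j))
    (hface : ∀ y : ℕ → V, (∀ i < k, y i = a i ∨ y i = b i) →
      ∀ W, W ⊆ (Finset.range k).image y → W ∈ Δ)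
    (hrep : ∀ W ∈ Δ, W.card = k + 1 → ∃ x ∈ W, ∃ y ∈ W, x ≠ y ∧ ∀ i < k, g i x = g i y) :
    0 < Module.finrank ℂ (ReducedHomology Δ k) := by
  have hz : diffProduct a b k ∈ cycles Δ k := by
    refine ⟨fun W hW => ?_, ?_⟩
    · obtain ⟨hcard, y, hy, hsub⟩ := diffProduct_support a b k W hW
      exact ⟨hface y hy W hsub, hcard⟩
    · change boundary V _ = 0
      rw [boundary_eq_contraction]
      exact contraction_diffProduct _ a b k fun _ _ => rfl
  have hnz : diffProduct a b k ∉ boundaries Δ k := by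
    rintro ⟨c, hc, hcz⟩
    have h := iterContraction_boundary g k c fun W hW => hrep W (hc W hW).1 (hc W hW).2
    rw [hcz, iterContraction_diffProduct g a b k h1 h0] at h
    exact one_ne_zero h
  have : Nontrivial (ReducedHomology Δ k) := by
    rw [Submodule.Quotient.nontrivial_iff]
    intro htop
    have hmem : (⟨_, hz⟩ : cycles Δ k) ∈ (boundaries Δ k).submoduleOf (cycles Δ k) := by
      rw [htop]; trivial
    exact hnz hmem
  exact Module.finrank_pos

end Operators

section CutSystems

variable {V E : Type*}

theorem edgeCount_comm (G : Graph V E) (u v : V) : edgeCount G u v = edgeCount G v u := by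
  unfold edgeCount
  congr 1
  ext e
  exact ⟨fun h => h.symm, fun h => h.symm⟩

theorem edgeCount_eq_zero {G : Graph V E} {u v : V} (h : ¬ (underlying G).Adj u v) (hne : u ≠ v) :
    edgeCount G u v = 0 := by
  have : {e : E | G.IsLink e u v} = ∅ := by
    ext e
    simp only [Set.mem_ofPred_eq, Set.mem_empty_iff_false, iff_false]
    exact fun he => h ⟨hne, e, he⟩
  rw [edgeCount, this, Set.ncard_empty]

theorem edgeCount_pos [Finite E] {G : Graph V E} {u v : V} (h : (underlying G).Adj u v) :
    0 < edgeCount G u v := by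
  obtain ⟨-, e, he⟩ := h
  exact (Set.ncard_pos (Set.toFinite _)).2 ⟨e, he⟩

theorem degree_eq_sum [Fintype V] [DecidableEq V] [Finite E] (G : Graph V E) (v : V) :
    degree G v = ∑ u ∈ Finset.univ.erase v, edgeCount G v u := by
  classical
  have := Fintype.ofFinite E
  have h : {e : E | G.IsNonloopAt e v} =
      ((Finset.univ.erase v).biUnion fun u => Finset.univ.filter fun e => G.IsLink e v u :
        Finset E) := by
    ext e
    simp [Graph.IsNonloopAt]
  rw [degree, h, Set.ncard_coe_finset, Finset.card_biUnion]
  · refine Finset.sum_congr rfl fun u _ => ?_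
    rw [edgeCount, ← Set.ncard_coe_finset]
    congr 1
    ext e
    simp
  · intro u _ w _ huw
    rw [Function.onFun, Finset.disjoint_left]
    intro e he hw
    simp only [Finset.mem_filter, Finset.mem_univ, true_and] at he hw
    exact huw (he.right_unique hw)

theorem laplacian_mulVec [Fintype V] [DecidableEq V] [Finite E] (G : Graph V E) (f : V → ℤ)
    (v : V) : (laplacian G *ᵥ f) v = ∑ u, (edgeCount G v u : ℤ) * (f v - f u) := by
  rw [Matrix.mulVec, dotProduct, ← Finset.add_sum_erase _ _ (Finset.mem_univ v),
    ← Finset.add_sum_erase _ (fun u => (edgeCount G v u : ℤ) * (f v - f u)) (Finset.mem_univ v)]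
  have h : ∀ u ∈ Finset.univ.erase v, laplacian G v u * f u = -(edgeCount G v u : ℤ) * f u := by
    intro u hu
    simp [laplacian, (Finset.ne_of_mem_erase hu).symm]
  rw [Finset.sum_congr rfl h]
  simp only [laplacian, Matrix.of_apply, if_true, degree_eq_sum, Nat.cast_sum, sub_self, mul_zero,
    zero_add, Finset.sum_mul, ← Finset.sum_add_distrib]
  exact Finset.sum_congr rfl fun u _ => by ring

theorem laplacian_mulVec_eq_zero [Fintype V] [DecidableEq V] [Finite E] (G : Graph V E)
    (f : V → ℤ) (hf : ∀ u v, (underlying G).Adj u v → f u = f v) : laplacian G *ᵥ f = 0 := by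
  funext v
  rw [laplacian_mulVec]
  refine Finset.sum_eq_zero fun u _ => ?_
  by_cases h : (underlying G).Adj v u
  · rw [hf v u h, sub_self, mul_zero]
  · rcases eq_or_ne v u with rfl | hne
    · rw [sub_self, mul_zero]
    · rw [edgeCount_eq_zero h hne, Nat.cast_zero, zero_mul]

theorem laplacian_symm [Fintype V] [DecidableEq V] (G : Graph V E) (f g : V → ℤ) :
    f ⬝ᵥ (laplacian G *ᵥ g) = (laplacian G *ᵥ f) ⬝ᵥ g := by
  have h : (laplacian G)ᵀ = laplacian G := by
    ext u v
    rcases eq_or_ne u v with rfl | hne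
    · rfl
    · simp [laplacian, hne, hne.symm, edgeCount_comm]
  rw [Matrix.dotProduct_mulVec, ← Matrix.mulVec_transpose, h]

/-- Edges `a i b i`, for `i < k`, of a graph together with functions `h i` on the vertices such
that `h i` drops by one along the edge `a i b i` and is constant along all others. -/
structure IsCutSystem (G : Graph V E) (k : ℕ) (a b : ℕ → V) (h : ℕ → V → ℤ) : Prop where
  adj : ∀ i < k, (underlying G).Adj (a i) (b i)
  diff : ∀ i < k, h i (a i) - h i (b i) = 1
  diff_of_ne : ∀ i < k, ∀ j < k, i ≠ j → h i (a j) = h i (b j)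
  crossing : ∀ i < k, ∀ u v, (underlying G).Adj u v → h i u ≠ h i v →
    (u = a i ∧ v = b i) ∨ (u = b i ∧ v = a i)

/-- The sum of the chosen end vertices with the multiplicities of the edges. -/
noncomputable def endDivisor [DecidableEq V] (G : Graph V E) (k : ℕ) (a b y : ℕ → V) : V → ℤ :=
  ∑ i ∈ Finset.range k, (edgeCount G (a i) (b i) : ℤ) • Pi.single (y i) 1

namespace IsCutSystem

variable [Fintype V] [DecidableEq V] [Finite E] {G : Graph V E} {k : ℕ} {a b : ℕ → V}
  {h : ℕ → V → ℤ}

theorem laplacian_mulVec (H : IsCutSystem G k a b h) {i : ℕ} (hi : i < k) :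
    laplacian G *ᵥ h i =
      (edgeCount G (a i) (b i) : ℤ) • (Pi.single (a i) 1 - Pi.single (b i) 1) := by
  have hab := (H.adj i hi).1
  have hd := H.diff i hi
  have key : ∀ v u, ¬ ((v = a i ∧ u = b i) ∨ (v = b i ∧ u = a i)) →
      (edgeCount G v u : ℤ) * (h i v - h i u) = 0 := by
    intro v u hn
    by_cases hh : h i v = h i u
    · rw [hh, sub_self, mul_zero]
    · rw [edgeCount_eq_zero (fun hadj => hn (H.crossing i hi v u hadj hh))
        (fun e => hh (by rw [e])), Nat.cast_zero, zero_mul]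
  funext v
  rw [Sandpile.laplacian_mulVec]
  by_cases hva : v = a i
  · subst hva
    rw [Finset.sum_eq_single_of_mem (b i) (Finset.mem_univ _), hd]
    · simp [hab]
    · intro u _ hu
      exact key _ _ (by simp [hu, hab])
  by_cases hvb : v = b i
  · subst hvb
    rw [Finset.sum_eq_single_of_mem (a i) (Finset.mem_univ _), edgeCount_comm]
    · have : h i (b i) - h i (a i) = -1 := by omega
      simp [this, hva]
    · intro u _ hu
      exact key _ _ (by simp [hu, hva])
  · rw [Finset.sum_eq_zero fun u _ => key _ _ (by simp [hva, hvb])]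
    simp [hva, hvb]

/-- The Laplacian of a function that is constant where all the `h i` are. -/
theorem laplacian_mulVec_of_const (H : IsCutSystem G k a b h) (χ : V → ℤ)
    (hχ : ∀ u v, (∀ i < k, h i u = h i v) → χ u = χ v) :
    laplacian G *ᵥ χ = ∑ i ∈ Finset.range k, (χ (a i) - χ (b i)) •
      (edgeCount G (a i) (b i) : ℤ) • (Pi.single (a i) 1 - Pi.single (b i) 1) := by
  have h0 : laplacian G *ᵥ (χ - ∑ i ∈ Finset.range k, (χ (a i) - χ (b i)) • h i) = 0 := by
    refine laplacian_mulVec_eq_zero G _ fun u v huv => ?_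
    have key : ∀ i < k,
        (χ - ∑ j ∈ Finset.range k, (χ (a j) - χ (b j)) • h j) (a i) =
          (χ - ∑ j ∈ Finset.range k, (χ (a j) - χ (b j)) • h j) (b i) := by
      intro i hi
      have : ∑ j ∈ Finset.range k, ((χ (a j) - χ (b j)) * h j (a i) -
          (χ (a j) - χ (b j)) * h j (b i)) = χ (a i) - χ (b i) := by
        rw [Finset.sum_eq_single_of_mem i (Finset.mem_range.2 hi), ← mul_sub, H.diff i hi, mul_one]
        intro j hj hji
        rw [H.diff_of_ne j (Finset.mem_range.1 hj) i hi hji, sub_self]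
      rw [Finset.sum_sub_distrib] at this
      simp only [Pi.sub_apply, Finset.sum_apply, Pi.smul_apply, smul_eq_mul]
      linarith
    by_cases hall : ∀ i < k, h i u = h i v
    · simp only [Pi.sub_apply, Finset.sum_apply, Pi.smul_apply, hχ u v hall]
      congr 1
      exact Finset.sum_congr rfl fun i hi => by rw [hall i (Finset.mem_range.1 hi)]
    · push Not at hall
      obtain ⟨i, hi, hne⟩ := hall
      rcases H.crossing i hi u v huv hne with ⟨rfl, rfl⟩ | ⟨rfl, rfl⟩
      · exact key i hi
      · exact (key i hi).symm
  rw [Matrix.mulVec_sub, sub_eq_zero, Matrix.mulVec_sum] at h0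
  rw [h0]
  refine Finset.sum_congr rfl fun i hi => ?_
  rw [Matrix.mulVec_smul, H.laplacian_mulVec (Finset.mem_range.1 hi)]

theorem dotProduct_laplacian_mulVec (H : IsCutSystem G k a b h) (χ σ : V → ℤ)
    (hχ : ∀ u v, (∀ i < k, h i u = h i v) → χ u = χ v) :
    χ ⬝ᵥ (laplacian G *ᵥ σ) = ∑ i ∈ Finset.range k,
      (edgeCount G (a i) (b i) : ℤ) * ((χ (a i) - χ (b i)) * (σ (a i) - σ (b i))) := by
  rw [laplacian_symm, H.laplacian_mulVec_of_const χ hχ, sum_dotProduct]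
  refine Finset.sum_congr rfl fun i _ => ?_
  simp only [smul_dotProduct, sub_dotProduct, single_dotProduct, smul_eq_mul]
  ring

theorem divEquiv_endDivisor (H : IsCutSystem G k a b h) {x y : ℕ → V}
    (hx : ∀ i < k, x i = a i ∨ x i = b i) (hy : ∀ i < k, y i = a i ∨ y i = b i) :
    DivEquiv G (endDivisor G k a b x) (endDivisor G k a b y) := by
  have hex : ∀ i, ∃ t : ℤ, i < k → (edgeCount G (a i) (b i) : ℤ) •
      (Pi.single (x i) 1 - Pi.single (y i) 1 : V → ℤ) = laplacian G *ᵥ (t • h i) := by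
    intro i
    by_cases hi : i < k
    · simp only [hi, true_imp_iff, Matrix.mulVec_smul, H.laplacian_mulVec hi]
      rcases hx i hi with h1 | h1 <;> rcases hy i hi with h2 | h2 <;> rw [h1, h2]
      · exact ⟨0, by simp⟩
      · exact ⟨1, by simp⟩
      · exact ⟨-1, by rw [neg_one_smul, ← smul_neg, neg_sub]⟩
      · exact ⟨0, by simp⟩
    · exact ⟨0, fun h => absurd h hi⟩
  choose t ht using hex
  refine ⟨∑ i ∈ Finset.range k, t i • h i, ?_⟩
  rw [Matrix.mulVec_sum, ← Finset.sum_congr rfl fun i hi => ht i (Finset.mem_range.1 hi)]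
  simp only [endDivisor, smul_sub, Finset.sum_sub_distrib]
  abel

theorem mem_complexOf (H : IsCutSystem G k a b h) {x y : ℕ → V}
    (hx : ∀ i < k, x i = a i ∨ x i = b i) (hy : ∀ i < k, y i = a i ∨ y i = b i) {W : Finset V}
    (hW : W ⊆ (Finset.range k).image y) : W ∈ complexOf G (endDivisor G k a b x) := by
  have hnn : ∀ i v, 0 ≤ ((edgeCount G (a i) (b i) : ℤ) • (Pi.single (y i) 1 : V → ℤ)) v := by
    intro i v
    rw [Pi.smul_apply, Pi.single_apply]
    split_ifs <;> simp
  refine ⟨endDivisor G k a b y, ⟨H.divEquiv_endDivisor hx hy, fun v => ?_⟩, fun v hv => ?_⟩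
  · rw [endDivisor, Finset.sum_apply]
    exact Finset.sum_nonneg fun i _ => hnn i v
  · obtain ⟨i, hi, rfl⟩ := Finset.mem_image.1 (hW hv)
    rw [Function.mem_support, endDivisor, Finset.sum_apply]
    refine (Finset.sum_pos' (fun j _ => hnn j _) ⟨i, hi, ?_⟩).ne'
    simpa using edgeCount_pos (H.adj i (Finset.mem_range.1 hi))

/-- A face with more than `k` vertices has two vertices that no `h i` separates. -/
theorem exists_ne_of_mem_complexOf (H : IsCutSystem G k a b h) {x : ℕ → V}
    (hx : ∀ i < k, x i = a i ∨ x i = b i) {W : Finset V}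
    (hW : W ∈ complexOf G (endDivisor G k a b x)) (hcard : W.card = k + 1) :
    ∃ u ∈ W, ∃ v ∈ W, u ≠ v ∧ ∀ i < k, h i u = h i v := by
  obtain ⟨D', ⟨⟨σ, hσ⟩, hnn⟩, hsupp⟩ := hW
  by_contra! hcon
  have hhead : ∀ i, ∃ y : V, i < k → ∀ χ : V → ℤ, (∀ v, 0 ≤ χ v) → χ y = 0 →
      χ (x i) - (χ (a i) - χ (b i)) * (σ (a i) - σ (b i)) ≤ 0 := by
    intro i
    by_cases hi : i < k
    · simp only [hi, true_imp_iff]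
      rcases hx i hi with h1 | h1 <;> rw [h1]
      · rcases le_or_gt (σ (a i) - σ (b i)) 0 with ht | ht
        · exact ⟨a i, fun χ hχ h0 => by nlinarith [hχ (b i)]⟩
        · exact ⟨b i, fun χ hχ h0 => by nlinarith [hχ (a i)]⟩
      · rcases lt_or_ge (σ (a i) - σ (b i)) 0 with ht | ht
        · exact ⟨a i, fun χ hχ h0 => by nlinarith [hχ (b i)]⟩
        · exact ⟨b i, fun χ hχ h0 => by nlinarith [hχ (a i)]⟩
    · exact ⟨a i, fun h => absurd h hi⟩
  choose y hy using hhead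
  let sig : V → Fin k → ℤ := fun v i => h i v
  have hsig : ∀ u v, sig u = sig v ↔ ∀ i < k, h i u = h i v := fun u v =>
    ⟨fun e i hi => congrFun e ⟨i, hi⟩, fun e => funext fun i => e i i.2⟩
  have hinj : (W.image sig).card = k + 1 := by
    rw [Finset.card_image_of_injOn, hcard]
    intro u hu v hv huv
    by_contra hne
    obtain ⟨i, hi, hi'⟩ := hcon u hu v hv hne
    exact hi' ((hsig u v).1 huv i hi)
  obtain ⟨w, hw, hwy⟩ : ∃ w ∈ W, ∀ i < k, sig (y i) ≠ sig w := by
    by_contra! hall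
    have hsub : W.image sig ⊆ (Finset.range k).image fun i => sig (y i) := by
      intro s hs
      obtain ⟨w, hw, rfl⟩ := Finset.mem_image.1 hs
      obtain ⟨i, hi, hiw⟩ := hall w hw
      exact Finset.mem_image.2 ⟨i, Finset.mem_range.2 hi, hiw⟩
    have := (Finset.card_le_card hsub).trans Finset.card_image_le
    rw [hinj, Finset.card_range] at this
    omega
  let χ : V → ℤ := fun v => if sig v = sig w then 1 else 0
  have hχ0 : ∀ v, 0 ≤ χ v := fun v => by
    simp only [χ]; split_ifs <;> simp
  have hdot : χ ⬝ᵥ D' = ∑ i ∈ Finset.range k, (edgeCount G (a i) (b i) : ℤ) *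
      (χ (x i) - (χ (a i) - χ (b i)) * (σ (a i) - σ (b i))) := by
    rw [← hσ, dotProduct_sub, H.dotProduct_laplacian_mulVec χ σ, endDivisor, dotProduct_sum,
      ← Finset.sum_sub_distrib]
    · refine Finset.sum_congr rfl fun i _ => ?_
      simp only [dotProduct_smul, dotProduct_single, smul_eq_mul]
      ring
    · intro u v huv
      simp only [χ, (hsig u v).2 huv]
  have hle : χ ⬝ᵥ D' ≤ 0 := by
    rw [hdot]
    refine Finset.sum_nonpos fun i hi => mul_nonpos_of_nonneg_of_nonpos (by positivity) ?_
    rw [Finset.mem_range] at hi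
    exact hy i hi χ hχ0 (if_neg (hwy i hi))
  have hpos : 0 < χ ⬝ᵥ D' := by
    refine Finset.sum_pos' (fun v _ => mul_nonneg (hχ0 v) (hnn v)) ⟨w, Finset.mem_univ w, ?_⟩
    simp only [χ, if_true, one_mul]
    exact lt_of_le_of_ne (hnn w) (Ne.symm (hsupp hw))
  exact hle.not_gt hpos

end IsCutSystem

theorem IsCutSystem.betti_pos [Fintype V] [LinearOrder V] [Finite E] {G : Graph V E} {k : ℕ}
    {a b : ℕ → V} {h : ℕ → V → ℤ} (H : IsCutSystem G k a b h) {x : ℕ → V}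
    (hx : ∀ i < k, x i = a i ∨ x i = b i) :
    0 < betti G k (endDivisor G k a b x) := by
  refine finrank_reducedHomology_pos _ k a b (fun i v => (h i v : ℂ)) ?_ ?_ ?_ ?_
  · intro i hi
    exact_mod_cast H.diff i hi
  · intro i hi j hj
    exact_mod_cast H.diff_of_ne i hi j (hj.trans hi) hj.ne'
  · exact fun y hy W hW => H.mem_complexOf hx hy hW
  · intro W hW hcard
    obtain ⟨u, hu, v, hv, hne, hh⟩ := H.exists_ne_of_mem_complexOf hx hW hcard
    exact ⟨u, hu, v, hv, hne, fun i hi => by exact_mod_cast hh i hi⟩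

end CutSystems

section Cuts

variable {V E : Type*}

theorem IsConnectedSet.eq_of_adj {α : Type*} {G : Graph V E} {A : Finset V}
    (hA : IsConnectedSet G A) (f : V → α)
    (hf : ∀ u ∈ A, ∀ v ∈ A, (underlying G).Adj u v → f u = f v) {u v : V} (hu : u ∈ A)
    (hv : v ∈ A) : f u = f v := by
  have key : ∀ x y : (A : Set V), ((underlying G).induce (A : Set V)).Walk x y → f x = f y := by
    intro x y p
    induction p with
    | nil => rfl
    | cons hadj _ ih => exact (hf _ (Subtype.coe_prop _) _ (Subtype.coe_prop _) hadj).trans ih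
  obtain ⟨p⟩ := hA.preconnected ⟨u, hu⟩ ⟨v, hv⟩
  exact key _ _ p

theorem IsConnectedSet.nonempty {G : Graph V E} {A : Finset V} (hA : IsConnectedSet G A) :
    A.Nonempty := by
  obtain ⟨x⟩ := SimpleGraph.Connected.nonempty hA
  exact ⟨x, x.2⟩

theorem IsMultiEdgedTree.isConnectedSet_univ [Fintype V] {G : Graph V E}
    (hG : IsMultiEdgedTree G) : IsConnectedSet G Finset.univ := by
  rw [IsConnectedSet, Finset.coe_univ]
  exact (SimpleGraph.induceUnivIso (underlying G)).connected_iff.2 hG.isTree.1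

/-- In a tree, the side of an edge `a b` containing `a` is bounded by this edge only. -/
theorem IsMultiEdgedTree.exists_sideFunction {G : Graph V E} (hG : IsMultiEdgedTree G) {a b : V}
    (hab : (underlying G).Adj a b) : ∃ h : V → ℤ, h a - h b = 1 ∧
      ∀ u v, (underlying G).Adj u v → h u ≠ h v → (u = a ∧ v = b) ∨ (u = b ∧ v = a) := by
  classical
  have hbr := SimpleGraph.isAcyclic_iff_forall_adj_isBridge.1 hG.isTree.2 hab
  rw [SimpleGraph.isBridge_iff] at hbr
  refine ⟨fun v => if ((underlying G).deleteEdges {s(a, b)}).Reachable a v then 1 else 0, ?_, ?_⟩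
  · simp [hbr]
  · intro u v huv hne
    by_contra hcon
    apply hne
    have hadj : ((underlying G).deleteEdges {s(a, b)}).Adj u v := by
      rw [SimpleGraph.deleteEdges_adj]
      exact ⟨huv, by simpa using hcon⟩
    have : ((underlying G).deleteEdges {s(a, b)}).Reachable a u ↔
        ((underlying G).deleteEdges {s(a, b)}).Reachable a v :=
      ⟨fun h => h.trans hadj.reachable, fun h => h.trans hadj.symm.reachable⟩
    simp only [this]

/-- The two components of a cut are joined by exactly one edge of the underlying tree. -/
theorem IsCut.exists_edge [DecidableEq V] {G : Graph V E} (hG : IsMultiEdgedTree G)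
    {C A B : Finset V} (hC : IsConnectedSet G C) (hcut : IsCut G C A B) :
    ∃ a ∈ A, ∃ b ∈ B, (underlying G).Adj a b ∧
      ∀ u ∈ A, ∀ v ∈ B, (underlying G).Adj u v → u = a ∧ v = b := by
  have hdisj := Finset.disjoint_left.1 hcut.disjoint
  obtain ⟨a, ha, b, hb, hab⟩ : ∃ a ∈ A, ∃ b ∈ B, (underlying G).Adj a b := by
    by_contra! hcon
    obtain ⟨u, hu⟩ := hcut.connected_left.nonempty
    obtain ⟨v, hv⟩ := hcut.connected_right.nonempty
    have := hC.eq_of_adj (fun w => w ∈ A) (u := u) (v := v) ?_ ?_ ?_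
    · exact hdisj (this ▸ hu) hv
    · intro x hx y hy hxy
      rw [← hcut.union_eq, Finset.mem_union] at hx hy
      rcases hx with hx | hx <;> rcases hy with hy | hy
      · simp [hx, hy]
      · exact absurd hxy (hcon x hx y hy)
      · exact absurd hxy.symm (hcon y hy x hx)
      · have hx' : x ∉ A := fun h => hdisj h hx
        have hy' : y ∉ A := fun h => hdisj h hy
        simp [hx', hy']
    · exact hcut.union_eq ▸ Finset.mem_union_left B hu
    · exact hcut.union_eq ▸ Finset.mem_union_right A hv
  refine ⟨a, ha, b, hb, hab, fun u hu v hv huv => ?_⟩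
  obtain ⟨h, hd, hcross⟩ := hG.exists_sideFunction hab
  have hA : h u = h a := by
    refine hcut.connected_left.eq_of_adj h (fun x hx y hy hxy => ?_) hu ha
    by_contra hne
    rcases hcross x y hxy hne with ⟨-, rfl⟩ | ⟨rfl, -⟩
    · exact hdisj hy hb
    · exact hdisj hx hb
  have hB : h v = h b := by
    refine hcut.connected_right.eq_of_adj h (fun x hx y hy hxy => ?_) hv hb
    by_contra hne
    rcases hcross x y hxy hne with ⟨rfl, -⟩ | ⟨-, rfl⟩
    · exact hdisj ha hx
    · exact hdisj ha hy
  rcases hcross u v huv (by omega) with h | ⟨rfl, -⟩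
  · exact h
  · exact absurd hb (hdisj hu)

theorem crossingDegree_eq {G : Graph V E} {A B : Finset V}
    (hdisj : Disjoint A B) {a b : V} (ha : a ∈ A) (hb : b ∈ B)
    (huniq : ∀ u ∈ A, ∀ v ∈ B, (underlying G).Adj u v → u = a ∧ v = b) {v : V} :
    crossingDegree G A B v = {e : E | G.IsLink e a b ∧ (v = a ∨ v = b)}.ncard := by
  rw [crossingDegree]
  congr 1
  ext e
  constructor
  · rintro ⟨hinc, u, hu, w, hw, he⟩
    obtain ⟨rfl, rfl⟩ := huniq u hu w hw
      ⟨fun h => Finset.disjoint_left.1 hdisj hu (h ▸ hw), e, he⟩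
    exact ⟨he, hinc.eq_or_eq_of_isLink he⟩
  · rintro ⟨he, rfl | rfl⟩
    · exact ⟨he.inc_left, _, ha, _, hb, he⟩
    · exact ⟨he.inc_right, _, ha, _, hb, he⟩

/-- The crossing-degrees of a cut, restricted to one component, are concentrated at one end of the
cut edge. -/
theorem restrict_crossingDegree [DecidableEq V] {G : Graph V E} {A B X : Finset V}
    (hdisj : Disjoint A B) {a b : V} (ha : a ∈ A) (hb : b ∈ B)
    (huniq : ∀ u ∈ A, ∀ v ∈ B, (underlying G).Adj u v → u = a ∧ v = b) (hX : X = A ∨ X = B) :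
    ∃ x, (x = a ∨ x = b) ∧ ∀ v, (if v ∈ X then (crossingDegree G A B v : ℤ) else 0) =
      (edgeCount G a b : ℤ) * (Pi.single x 1 : V → ℤ) v := by
  have hd := Finset.disjoint_left.1 hdisj
  have key : ∀ v, (crossingDegree G A B v : ℤ) =
      if v = a ∨ v = b then (edgeCount G a b : ℤ) else 0 := by
    intro v
    rw [crossingDegree_eq hdisj ha hb huniq]
    split_ifs with h
    · simp [h, edgeCount]
    · simp [h]
  simp only [key, Pi.single_apply]
  rcases hX with rfl | rfl
  · refine ⟨a, Or.inl rfl, fun v => ?_⟩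
    by_cases hva : v = a
    · simp [hva, ha]
    · by_cases hvb : v = b
      · subst hvb
        have hvX : v ∉ X := fun h => hd h hb
        simp [hva, hvX]
      · simp [hva, hvb]
  · refine ⟨b, Or.inr rfl, fun v => ?_⟩
    by_cases hvb : v = b
    · simp [hvb, hb]
    · by_cases hva : v = a
      · subst hva
        simp [hvb, hd ha]
      · simp [hva, hvb]

variable [Fintype V] [DecidableEq V] {G : Graph V E} {k : ℕ}
  {P : Finpartition (Finset.univ : Finset V)} {A B : ℕ → Finset V}

theorem IsGeneratingSequence.exists_isCut (H : IsGeneratingSequence G k P A B)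
    (hG : IsMultiEdgedTree G) : ∀ i < k, ∃ C, IsConnectedSet G C ∧ IsCut G C (A i) (B i)
  | 0, h => ⟨_, hG.isConnectedSet_univ, H.first h⟩
  | i + 1, h => by
    obtain ⟨C, -, hcut⟩ := H.exists_isCut hG i (by omega)
    rcases H.next i h with h' | h'
    · exact ⟨_, hcut.connected_left, h'⟩
    · exact ⟨_, hcut.connected_right, h'⟩

theorem IsGeneratingSequence.union_subset (H : IsGeneratingSequence G k P A B) {i j : ℕ}
    (hij : i < j) (hj : j < k) : A j ∪ B j ⊆ A i ∨ A j ∪ B j ⊆ B i := by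
  induction j, hij using Nat.le_induction with
  | base =>
    rcases H.next i hj with h | h
    · exact Or.inl h.union_eq.subset
    · exact Or.inr h.union_eq.subset
  | succ j _ ih =>
    have hsub : A (j + 1) ∪ B (j + 1) ⊆ A j ∪ B j := by
      rcases H.next j hj with h | h
      · exact h.union_eq.subset.trans Finset.subset_union_left
      · exact h.union_eq.subset.trans Finset.subset_union_right
    exact (ih (by omega)).imp hsub.trans hsub.trans

theorem IsGeneratingSequence.exists_isCutSystem (H : IsGeneratingSequence G k P A B)
    (hG : IsMultiEdgedTree G) {X : ℕ → Finset V} (hX : ∀ i < k, X i = A i ∨ X i = B i) :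
    ∃ (a b x : ℕ → V) (h : ℕ → V → ℤ), IsCutSystem G k a b h ∧
      (∀ i < k, x i = a i ∨ x i = b i) ∧
      ∀ i < k, ∀ v, (if v ∈ X i then (crossingDegree G (A i) (B i) v : ℤ) else 0) =
        (edgeCount G (a i) (b i) : ℤ) * (Pi.single (x i) 1 : V → ℤ) v := by
  have := hG.isTree.1.nonempty
  have hex : ∀ i, ∃ (a b x : V) (h : V → ℤ), i < k → Disjoint (A i) (B i) ∧ a ∈ A i ∧ b ∈ B i ∧
      (underlying G).Adj a b ∧ (h a - h b = 1 ∧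
        ∀ u v, (underlying G).Adj u v → h u ≠ h v → (u = a ∧ v = b) ∨ (u = b ∧ v = a)) ∧
      (x = a ∨ x = b) ∧
      ∀ v, (if v ∈ X i then (crossingDegree G (A i) (B i) v : ℤ) else 0) =
        (edgeCount G a b : ℤ) * (Pi.single x 1 : V → ℤ) v := by
    intro i
    by_cases hi : i < k
    · obtain ⟨C, hC, hcut⟩ := H.exists_isCut hG i hi
      obtain ⟨a, ha, b, hb, hab, huniq⟩ := hcut.exists_edge hG hC
      obtain ⟨h, hh⟩ := hG.exists_sideFunction hab
      obtain ⟨x, hx⟩ := restrict_crossingDegree hcut.disjoint ha hb huniq (hX i hi)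
      exact ⟨a, b, x, h, fun _ => ⟨hcut.disjoint, ha, hb, hab, hh, hx⟩⟩
    · obtain ⟨v⟩ := this
      exact ⟨v, v, v, 0, fun h => absurd h hi⟩
  choose a b x h hdisj ha hb hadj hside hx hval using hex
  have hsep : ∀ i j, i < j → j < k →
      ¬ ((a j = a i ∧ b j = b i) ∨ (a j = b i ∧ b j = a i)) := by
    intro i j hij hj hcon
    have hi := hij.trans hj
    have hd := Finset.disjoint_left.1 (hdisj i hi)
    have haj := Finset.mem_union_left (B j) (ha j hj)
    have hbj := Finset.mem_union_right (A j) (hb j hj)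
    have hai := ha i hi
    have hbi := hb i hi
    rcases H.union_subset hij hj with hs | hs <;> rcases hcon with ⟨h1, h2⟩ | ⟨h1, h2⟩
    · exact hd (h2 ▸ hs hbj) hbi
    · exact hd (h1 ▸ hs haj) hbi
    · exact hd hai (h1 ▸ hs haj)
    · exact hd hai (h2 ▸ hs hbj)
  refine ⟨a, b, x, h, ⟨hadj, fun i hi => (hside i hi).1, ?_, fun i hi => (hside i hi).2⟩, hx, hval⟩
  intro i hi j hj hij
  by_contra hne
  have hcon := (hside i hi).2 _ _ (hadj j hj) hne
  rcases lt_or_gt_of_ne hij with hlt | hlt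
  · exact hsep i j hlt hj hcon
  · refine hsep j i hlt hi ?_
    rcases hcon with ⟨h1, h2⟩ | ⟨h1, h2⟩
    · exact Or.inl ⟨h1.symm, h2.symm⟩
    · exact Or.inr ⟨h2.symm, h1.symm⟩

end Cuts

end Sandpile

theorem proposition6p1 {V E : Type*} [Fintype V] [LinearOrder V] [Finite E]
    (G : Graph V E) (hG : Sandpile.IsMultiEdgedTree G)
    (k : ℕ) (hk : 1 ≤ k)
    (P : Finpartition (Finset.univ : Finset V))
    (hP : Sandpile.IsConnectedPartition G (k + 1) P)
    (D : V → ℤ) (hD : Sandpile.IsBoundaryDivisor G k P D) :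
    0 < Sandpile.betti G k D := by
  obtain ⟨A, B, H, X, hX, hval⟩ := hD
  obtain ⟨a, b, x, h, hsys, hx, hcd⟩ := H.exists_isCutSystem hG hX
  have hDx : D = Sandpile.endDivisor G k a b x := by
    funext v
    rw [hval, Sandpile.endDivisor, Finset.sum_apply]
    exact Finset.sum_congr rfl fun i hi => hcd i (Finset.mem_range.1 hi) v
  rw [hDx]
  exact hsys.betti_pos hx
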